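/- Let $k\ge 1$ and let $G$ be a finite simple graph with vertex set $V$, $|V|=n$. The $k$-core of $G$ is the maximal nonempty subgraph of $G$ in which every vertex has degree at least $k$ (within the subgraph); suppose that it exists and let $V_{k\text{-core}}$ be its vertex set. The $k$-adjacency tensor $\mathcal A^{(k)}(G)=(a_{i_1i_2\cdots i_{k+1}})$ is the tensor of order $k+1$ and dimension $n$ with $a_{i_1\cdots i_{k+1}}=\frac1{k!}$ if $i_1,\dots,i_{k+1}$ are distinct and $i_2,\dots,i_{k+1}$ are all neighbours of $i_1$, and $a_{i_1\cdots i_{k+1}}=0$ otherwise. A number $\lambda\in\mathbb C$ is an eigenvalue of $\mathcal A^{(k)}(G)$, with eigenvector $x\in\mathbb C^n\setminus\{0\}$, if $\sum_{i_2,\dots,i_{k+1}}a_{ii_2\cdots i_{k+1}}x_{i_2}\cdots x_{i_{k+1}}=\lambda x_i^{k}$ for every $i$; the spectral radius $\rho_k(G)$ is the largest modulus of an eigenvalue; a Perron eigenvector is an entrywise nonnegative eigenvector corresponding to $\rho_k(G)$. Let $\operatorname{supp}(x)=\{i : x_i\ne 0\}$. Then Perron eigenvectors of $\mathcal A^{(k)}(G)$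 exist, and every Perron eigenvector $x^{(k)}$ satisfies $$\operatorname{supp}(x^{(k)})\subseteq V_{k\text{-core}}.$$ Moreover, if the subgraph of $G$ induced by $V_{k\text{-core}}$ is connected, then $\operatorname{supp}(x^{(k)})=V_{k\text{-core}}$. -/

import Mathlib

namespace KCoreSpectra

/-- A complex tensor of order `m` whose indices range over `V` (dimension `n = |V|`). -/
abbrev Tensor (m : ℕ) (V : Type*) : Type _ := (Fin m → V) → ℂ

/-- The vector `A x^{k}` attached to a tensor `A` of order `k + 1`: its `i`-th entry is
`∑_{i₂, …, i_{k+1}} a_{i i₂ ⋯ i_{k+1}} x_{i₂} ⋯ x_{i_{k+1}}`. -/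
noncomputable def Tensor.applyVec {k : ℕ} {V : Type*} [Fintype V]
    (A : Tensor (k + 1) V) (x : V → ℂ) (i : V) : ℂ :=
  open Classical in
  ∑ f : Fin k → V, A (Fin.cons i f) * ∏ j, x (f j)

/-- `x` is an eigenvector of the tensor `A` of order `k + 1` corresponding to the number `μ`:
`x ≠ 0` and `A x^{k} = μ x^{[k]}`. -/
def Tensor.IsEigenvector {k : ℕ} {V : Type*} [Fintype V]
    (A : Tensor (k + 1) V) (μ : ℂ) (x : V → ℂ) : Prop :=
  x ≠ 0 ∧ ∀ i, A.applyVec x i = μ * x i ^ k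

/-- `μ` is an eigenvalue of the tensor `A`. -/
def Tensor.IsEigenvalue {k : ℕ} {V : Type*} [Fintype V]
    (A : Tensor (k + 1) V) (μ : ℂ) : Prop :=
  ∃ x : V → ℂ, A.IsEigenvector μ x

/-- `ρ` is the spectral radius of the tensor `A`: the largest modulus of its eigenvalues. -/
def Tensor.IsSpectralRadius {k : ℕ} {V : Type*} [Fintype V]
    (A : Tensor (k + 1) V) (ρ : ℝ) : Prop :=
  IsGreatest {r : ℝ | ∃ μ : ℂ, A.IsEigenvalue μ ∧ ‖μ‖ = r} ρ

/-- The `k`-adjacency tensor of a simple graph: the entry at `(i₁, …, i_{k+1})` is `1 / k!` if all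
indices are distinct and `i₂, …, i_{k+1}` are neighbours of `i₁`, and `0` otherwise. -/
noncomputable def adjTensor {V : Type*} (G : SimpleGraph V) (k : ℕ) : Tensor (k + 1) V :=
  open Classical in
  fun i => if (∀ j : Fin k, i j.succ ∈ G.neighborSet (i 0)) ∧ Function.Injective i
    then 1 / (k.factorial : ℂ) else 0

/-- `x` is a Perron eigenvector of the `k`-adjacency tensor of `G`: an entrywise nonnegative
eigenvector corresponding to the spectral radius of that tensor. -/
def IsPerronEigenvector {V : Type*} [Fintype V] (G : SimpleGraph V) (k : ℕ) (x : V → ℝ) : Prop :=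
  (∀ v, 0 ≤ x v) ∧
    ∃ ρ : ℝ, (adjTensor G k).IsSpectralRadius ρ ∧
      (adjTensor G k).IsEigenvector (ρ : ℂ) (fun v => (x v : ℂ))

/-- `H` is a `k`-core of the finite graph `G`: a maximal one among the nonempty subgraphs of `G`
in which every vertex has degree at least `k` (within the subgraph). -/
def IsKCore {V : Type*} [Fintype V] (G : SimpleGraph V) (k : ℕ) (H : G.Subgraph) : Prop :=
  Maximal (fun H' : G.Subgraph =>
    H'.verts.Nonempty ∧ ∀ v ∈ H'.verts, k ≤ (H'.neighborSet v).ncard) H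

end KCoreSpectra

open Filter Topology

namespace KCoreSpectra

/-! ### Perron–Frobenius theory for monotone homogeneous maps -/

section Perron

variable {V : Type*} [Fintype V] {k : ℕ}

/-! Write `P` for the polynomial map of the tensor. By the triangle inequality, the moduli of an
eigenvector for `μ` form a nonnegative sub-eigenvector for `‖μ‖`. So the spectral radius is the
largest sub-eigenvalue, once that is known to be an eigenvalue (`exists_perron_eigenvector`). It is
positive, as the indicator of the core shows.

If `x` is a Perron vector and `x v ≠ 0`, then `P x v > 0`, so some monomial at `v` is nonzero: `v`
has `k` distinct neighbours in the support. Hence the support has minimum degree at least `k` and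
lies in the core `C`.

If `C` induces a connected graph, `P` is weakly irreducible on `C`. Positive approximate
super-eigenvectors then have bounded ratios on `C`, and a limit `y` is an exact super-eigenvector,
positive on `C` (`exists_pos_supereigenvector`). Where `x / y` is maximal on `C`, all inequalities
are equalities; these propagate along arcs, so `x` is a positive multiple of `y` on `C`
(`pos_of_supereigenvector`). -/

theorem sum_pow_pos {x : V → ℝ} (hx : x ∈ stdSimplex ℝ V) : 0 < ∑ i, x i ^ k := by
  have hne : ∃ i, x i ≠ 0 := by
    by_contra! h
    have := hx.2
    simp [h] at this
  obtain ⟨i, hi⟩ := hne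
  exact Finset.sum_pos' (fun j _ => pow_nonneg (hx.1 j) k)
    ⟨i, Finset.mem_univ i, pow_pos (lt_of_le_of_ne (hx.1 i) hi.symm) k⟩

theorem sum_pos_of_nonneg_of_ne_zero {x : V → ℝ} (hx : 0 ≤ x) (h : x ≠ 0) : 0 < ∑ i, x i := by
  obtain ⟨i, hi⟩ := Function.ne_iff.mp h
  exact Finset.sum_pos' (fun j _ => hx j)
    ⟨i, Finset.mem_univ i, lt_of_le_of_ne (hx i) (Ne.symm hi)⟩

theorem inv_sum_smul_mem_stdSimplex {x : V → ℝ} (hx : 0 ≤ x) (h : x ≠ 0) :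
    (∑ i, x i)⁻¹ • x ∈ stdSimplex ℝ V := by
  have hs := sum_pos_of_nonneg_of_ne_zero hx h
  refine ⟨fun i => mul_nonneg (inv_nonneg.mpr hs.le) (hx i), ?_⟩
  simp only [Pi.smul_apply, smul_eq_mul, ← Finset.mul_sum]
  exact inv_mul_cancel₀ hs.ne'

/-- Among the sub-eigenvalues of a continuous homogeneous map with a nonnegative
sub-eigenvector there is a largest one. -/
theorem exists_max_subeigenvalue [Nonempty V] (P : (V → ℝ) → V → ℝ) (hc : Continuous P)
    (hnn : ∀ x, 0 ≤ x → 0 ≤ P x)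
    (hhom : ∀ c : ℝ, 0 ≤ c → ∀ x i, P (c • x) i = c ^ k * P x i) :
    ∃ (l : ℝ) (x : V → ℝ), 0 ≤ l ∧ x ∈ stdSimplex ℝ V ∧ (∀ i, l * x i ^ k ≤ P x i) ∧
      ∀ (μ : ℝ) (z : V → ℝ), 0 ≤ z → z ≠ 0 → (∀ i, μ * z i ^ k ≤ P z i) → μ ≤ l := by
  classical
  have hcP : ∀ i, Continuous fun x => P x i := fun i => (continuous_apply i).comp hc
  have hg : ContinuousOn (fun x : V → ℝ => (∑ i, P x i) / ∑ i, x i ^ k) (stdSimplex ℝ V) :=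
    ContinuousOn.div (by fun_prop) (by fun_prop) fun x hx => (sum_pow_pos hx).ne'
  obtain ⟨M, hM⟩ := (isCompact_stdSimplex ℝ V).bddAbove_image hg
  let K : Set (ℝ × (V → ℝ)) :=
    {p | p.2 ∈ stdSimplex ℝ V ∧ 0 ≤ p.1 ∧ ∀ i, p.1 * p.2 i ^ k ≤ P p.2 i}
  have hKM : K ⊆ Set.Icc 0 M ×ˢ stdSimplex ℝ V := by
    rintro ⟨l, x⟩ ⟨hx, hl, h⟩
    refine ⟨⟨hl, le_trans ?_ (hM ⟨x, hx, rfl⟩)⟩, hx⟩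
    change l ≤ _
    rw [le_div_iff₀ (sum_pow_pos hx), Finset.mul_sum]
    exact Finset.sum_le_sum fun i _ => h i
  have hKc : IsClosed K := by
    refine ((isCompact_stdSimplex ℝ V).isClosed.preimage continuous_snd).inter
      ((isClosed_le continuous_const continuous_fst).inter ?_)
    have : {p : ℝ × (V → ℝ) | ∀ i, p.1 * p.2 i ^ k ≤ P p.2 i} =
        ⋂ i, {p : ℝ × (V → ℝ) | p.1 * p.2 i ^ k ≤ P p.2 i} := by ext; simp
    change IsClosed {p : ℝ × (V → ℝ) | ∀ i, p.1 * p.2 i ^ k ≤ P p.2 i}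
    rw [this]
    exact isClosed_iInter fun i => isClosed_le (by fun_prop) ((hcP i).comp continuous_snd)
  have hKK : IsCompact K := (isCompact_Icc.prod (isCompact_stdSimplex ℝ V)).of_isClosed_subset hKc hKM
  have hKne : K.Nonempty := by
    refine ⟨(0, Pi.single (Classical.arbitrary V) 1), single_mem_stdSimplex ℝ _, le_rfl, fun i => ?_⟩
    rw [zero_mul]
    exact hnn _ (single_mem_stdSimplex ℝ (Classical.arbitrary V)).1 i
  obtain ⟨⟨l, x⟩, ⟨hx, hl, h⟩, hmax⟩ := hKK.exists_isMaxOn hKne continuous_fst.continuousOn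
  refine ⟨l, x, hl, hx, h, fun μ z hz hz0 hμ => ?_⟩
  rcases lt_or_ge μ 0 with hneg | hpos
  · exact hneg.le.trans hl
  have hs := sum_pos_of_nonneg_of_ne_zero hz hz0
  refine hmax (a := (μ, (∑ i, z i)⁻¹ • z)) ⟨inv_sum_smul_mem_stdSimplex hz hz0, hpos, fun i => ?_⟩
  have hs' : 0 ≤ (∑ i, z i)⁻¹ := inv_nonneg.mpr hs.le
  change μ * ((∑ i, z i)⁻¹ * z i) ^ k ≤ P ((∑ i, z i)⁻¹ • z) i
  rw [hhom _ hs', mul_pow, mul_left_comm]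
  exact mul_le_mul_of_nonneg_left (hμ i) (pow_nonneg hs' k)

/-- Perron–Frobenius for a strictly order preserving homogeneous map. -/
theorem exists_eigenvector_of_strictMono [Nonempty V] (hk : k ≠ 0) (P : (V → ℝ) → V → ℝ)
    (hc : Continuous P) (hnn : ∀ x, 0 ≤ x → 0 ≤ P x)
    (hhom : ∀ c : ℝ, 0 ≤ c → ∀ x i, P (c • x) i = c ^ k * P x i)
    (hmono : ∀ x y, 0 ≤ x → x ≤ y → x ≠ y → ∀ i, P x i < P y i) :
    ∃ (l : ℝ) (x : V → ℝ), 0 ≤ l ∧ x ∈ stdSimplex ℝ V ∧ (∀ i, P x i = l * x i ^ k) ∧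
      ∀ (μ : ℝ) (z : V → ℝ), 0 ≤ z → z ≠ 0 → (∀ i, μ * z i ^ k ≤ P z i) → μ ≤ l := by
  obtain ⟨l, x, hl, hx, h, hmax⟩ := exists_max_subeigenvalue P hc hnn hhom
  refine ⟨l, x, hl, hx, ?_, hmax⟩
  by_contra! hne
  obtain ⟨i₀, hi₀⟩ := hne
  have hx0 : 0 ≤ x := hx.1
  have hPx := hnn x hx0
  -- One step of power iteration: if `x` is not an eigenvector, strict monotonicity makes `y` a
  -- strict sub-eigenvector for `l`, so `l` could be increased.
  set y : V → ℝ := fun i => (P x i) ^ ((k : ℝ)⁻¹) with hy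
  have hy0 : 0 ≤ y := fun i => Real.rpow_nonneg (hPx i) _
  have hyk : ∀ i, y i ^ k = P x i := fun i => Real.rpow_inv_natCast_pow (hPx i) hk
  set c : ℝ := l ^ ((k : ℝ)⁻¹) with hcdef
  have hc0 : 0 ≤ c := Real.rpow_nonneg hl _
  have hck : c ^ k = l := Real.rpow_inv_natCast_pow hl hk
  have hle : c • x ≤ y := fun i => by
    refine le_of_pow_le_pow_left₀ hk (hy0 i) ?_
    rw [hyk, Pi.smul_apply, smul_eq_mul, mul_pow, hck]
    exact h i
  have hneq : c • x ≠ y := fun he => hi₀ <| by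
    rw [← hyk, ← he, Pi.smul_apply, smul_eq_mul, mul_pow, hck]
  have hlt : ∀ i, l * y i ^ k < P y i := fun i => by
    have := hmono (c • x) y (smul_nonneg hc0 hx0) hle hneq i
    rwa [hhom c hc0, hck, ← hyk] at this
  have hyne : y ≠ 0 := fun h0 => hneq (le_antisymm hle (by
    rw [h0]; exact smul_nonneg hc0 hx0))
  have hev : ∀ᶠ μ in 𝓝[>] l, ∀ i, μ * y i ^ k ≤ P y i := by
    refine Filter.eventually_all.mpr fun i => ?_
    have ht : Tendsto (fun μ : ℝ => μ * y i ^ k) (𝓝[>] l) (𝓝 (l * y i ^ k)) :=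
      ((continuous_id.mul continuous_const).tendsto l).mono_left nhdsWithin_le_nhds
    exact (ht.eventually (gt_mem_nhds (hlt i))).mono fun _ h => h.le
  obtain ⟨μ, hμ, hlμ⟩ := (hev.and self_mem_nhdsWithin).exists
  exact absurd (hmax μ y hy0 hyne hμ) (not_le.mpr hlμ)

/-- Perron–Frobenius for an order preserving homogeneous map: the largest sub-eigenvalue is an
eigenvalue with a nonnegative eigenvector, and is approximated by values having a positive
super-eigenvector. -/
theorem exists_perron_eigenvector [Nonempty V] (hk : k ≠ 0) (P : (V → ℝ) → V → ℝ)
    (hc : Continuous P) (hnn : ∀ x, 0 ≤ x → 0 ≤ P x)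
    (hhom : ∀ c : ℝ, 0 ≤ c → ∀ x i, P (c • x) i = c ^ k * P x i)
    (hmono : ∀ x y, 0 ≤ x → x ≤ y → P x ≤ P y) :
    ∃ (l : ℝ) (x : V → ℝ), 0 ≤ l ∧ x ∈ stdSimplex ℝ V ∧ (∀ i, P x i = l * x i ^ k) ∧
      (∀ (μ : ℝ) (z : V → ℝ), 0 ≤ z → z ≠ 0 → (∀ i, μ * z i ^ k ≤ P z i) → μ ≤ l) ∧
      ∀ δ > 0, ∃ z : V → ℝ, (∀ i, 0 < z i) ∧ ∀ i, P z i ≤ (l + δ) * z i ^ k := by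
  have hcP : ∀ i, Continuous fun x => P x i := fun i => (continuous_apply i).comp hc
  have hε : ∀ n : ℕ, (0 : ℝ) < 1 / ((n : ℝ) + 1) := fun n => Nat.one_div_pos_of_nat
  -- The added multiple of `(∑ j, x j) ^ k` makes the map strictly monotone and its eigenvectors
  -- positive.
  have key : ∀ n : ℕ, ∃ (l : ℝ) (x : V → ℝ), 0 ≤ l ∧ x ∈ stdSimplex ℝ V ∧
      (∀ i, P x i + 1 / ((n : ℝ) + 1) * (∑ j, x j) ^ k = l * x i ^ k) ∧
      ∀ (μ : ℝ) (z : V → ℝ), 0 ≤ z → z ≠ 0 →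
        (∀ i, μ * z i ^ k ≤ P z i + 1 / ((n : ℝ) + 1) * (∑ j, z j) ^ k) → μ ≤ l := by
    intro n
    refine exists_eigenvector_of_strictMono hk
      (fun x i => P x i + 1 / ((n : ℝ) + 1) * (∑ j, x j) ^ k) ?_ ?_ ?_ ?_
    · exact continuous_pi fun i => (hcP i).add (by fun_prop)
    · intro x hx i
      exact add_nonneg (hnn x hx i)
        (mul_nonneg (hε n).le (pow_nonneg (Finset.sum_nonneg fun j _ => hx j) k))
    · intro c hc0 x i
      simp only [hhom c hc0, Pi.smul_apply, smul_eq_mul, ← Finset.mul_sum, mul_pow]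
      ring
    · intro x y hx hxy hne i
      have hlt : ∑ j, x j < ∑ j, y j := by
        obtain ⟨j, hj⟩ := Function.ne_iff.mp hne
        exact Finset.sum_lt_sum (fun j _ => hxy j)
          ⟨j, Finset.mem_univ j, lt_of_le_of_ne (hxy j) hj⟩
      exact add_lt_add_of_le_of_lt (hmono x y hx hxy i) (mul_lt_mul_of_pos_left
        (pow_lt_pow_left₀ hlt (Finset.sum_nonneg fun j _ => hx j) hk) (hε n))
  choose l x hl hx heq hmax using key
  have heq' : ∀ n i, P (x n) i + 1 / ((n : ℝ) + 1) = l n * x n i ^ k := fun n i => by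
    rw [← heq n i, (hx n).2, one_pow, mul_one]
  obtain ⟨y, hy, φ, hφ, hlim⟩ := (isCompact_stdSimplex ℝ V).tendsto_subseq hx
  have hε0 : Tendsto (fun n => 1 / ((φ n : ℝ) + 1)) atTop (𝓝 0) :=
    (tendsto_one_div_add_atTop_nhds_zero_nat (𝕜 := ℝ)).comp hφ.tendsto_atTop
  have hPlim : ∀ i, Tendsto (fun n => P (x (φ n)) i + 1 / ((φ n : ℝ) + 1)) atTop (𝓝 (P y i)) :=
    fun i => by simpa using (((hcP i).tendsto y).comp hlim).add hε0
  have hxlim : ∀ i, Tendsto (fun n => x (φ n) i) atTop (𝓝 (y i)) := tendsto_pi_nhds.mp hlim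
  -- Summing the eigenvalue equations over coordinates expresses `l n` through `x n`, so the
  -- eigenvalues converge along the same subsequence.
  have hllim : Tendsto (fun n => l (φ n)) atTop (𝓝 ((∑ i, P y i) / ∑ i, y i ^ k)) := by
    have h1 := (tendsto_finsetSum Finset.univ fun i _ => hPlim i).div
      (tendsto_finsetSum Finset.univ fun i _ => (hxlim i).pow k) (sum_pow_pos (k := k) hy).ne'
    refine h1.congr fun n => ?_
    simp only [Pi.div_apply, heq', ← Finset.mul_sum]
    exact mul_div_cancel_right₀ _ (sum_pow_pos (hx _)).ne'
  refine ⟨(∑ i, P y i) / ∑ i, y i ^ k, y, ge_of_tendsto' hllim fun n => hl _, hy, fun i => ?_,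
    fun μ z hz hz0 h => ge_of_tendsto' hllim fun n => hmax _ μ z hz hz0 fun i => (h i).trans
      (le_add_of_nonneg_right (mul_nonneg (hε _).le
        (pow_nonneg (Finset.sum_nonneg fun j _ => hz j) k))), fun δ hδ => ?_⟩
  · refine tendsto_nhds_unique (hPlim i) ?_
    simp only [heq']
    exact hllim.mul ((hxlim i).pow k)
  · obtain ⟨n, hn⟩ := (hllim.eventually (gt_mem_nhds (lt_add_of_pos_right _ hδ))).exists
    refine ⟨x (φ n), fun i => lt_of_le_of_ne ((hx _).1 i) fun h0 => ?_, fun i => ?_⟩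
    · have := heq' (φ n) i
      rw [← h0, zero_pow hk, mul_zero] at this
      exact (add_pos_of_nonneg_of_pos (hnn _ (hx _).1 i) (hε _)).ne' this
    · calc P (x (φ n)) i ≤ P (x (φ n)) i + 1 / ((φ n : ℝ) + 1) :=
            le_add_of_nonneg_right (hε _).le
        _ = l (φ n) * x (φ n) i ^ k := heq' _ i
        _ ≤ _ := mul_le_mul_of_nonneg_right hn.le (pow_nonneg ((hx _).1 i) k)

end Perron

/-! ### Weakly irreducible polynomial maps -/

section WeightedForm

variable {V : Type*} [Fintype V] {k : ℕ}

/-- The homogeneous polynomial map of degree `k` with real coefficients `w`. -/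
noncomputable def weightedForm (w : V → (Fin k → V) → ℝ) (x : V → ℝ) (i : V) : ℝ :=
  ∑ f : Fin k → V, w i f * ∏ j, x (f j)

theorem continuous_weightedForm (w : V → (Fin k → V) → ℝ) : Continuous (weightedForm w) := by
  unfold weightedForm
  fun_prop

theorem weightedForm_smul (w : V → (Fin k → V) → ℝ) (c : ℝ) (x : V → ℝ) (i : V) :
    weightedForm w (c • x) i = c ^ k * weightedForm w x i := by
  simp only [weightedForm, Pi.smul_apply, smul_eq_mul, Finset.prod_mul_distrib,
    Finset.prod_const, Finset.card_univ, Fintype.card_fin, Finset.mul_sum]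
  exact Finset.sum_congr rfl fun f _ => mul_left_comm _ _ _

variable {w : V → (Fin k → V) → ℝ}

theorem weightedForm_nonneg (hw : ∀ i f, 0 ≤ w i f) {x : V → ℝ} (hx : 0 ≤ x) :
    0 ≤ weightedForm w x := fun i =>
  Finset.sum_nonneg fun f _ => mul_nonneg (hw i f) (Finset.prod_nonneg fun j _ => hx (f j))

theorem weightedForm_mono (hw : ∀ i f, 0 ≤ w i f) {x y : V → ℝ} (hx : 0 ≤ x) (hxy : x ≤ y) :
    weightedForm w x ≤ weightedForm w y := fun i =>
  Finset.sum_le_sum fun f _ => mul_le_mul_of_nonneg_left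
    (Finset.prod_le_prod (fun j _ => hx (f j)) fun j _ => hxy (f j)) (hw i f)

theorem mul_prod_le_weightedForm (hw : ∀ i f, 0 ≤ w i f) {x : V → ℝ} (hx : 0 ≤ x) (i : V)
    (f : Fin k → V) : w i f * ∏ j, x (f j) ≤ weightedForm w x i :=
  Finset.single_le_sum (f := fun f : Fin k → V => w i f * ∏ j, x (f j))
    (fun f _ => mul_nonneg (hw i f) (Finset.prod_nonneg fun j _ => hx (f j))) (Finset.mem_univ f)

/-- `j` occurs in a monomial, over `C` and with positive coefficient, of the `i`-th component of
the polynomial map with coefficients `w`. -/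
def FormArc (w : V → (Fin k → V) → ℝ) (C : Set V) (i j : V) : Prop :=
  ∃ f : Fin k → V, 0 < w i f ∧ (∀ l, f l ∈ C) ∧ j ∈ Set.range f

variable {C : Set V}

/-- The monomial of the arc is at most `K * z i ^ k`, and its factors other than `z j` are at least
`m`. Cancelling `m ^ (k - 1)` bounds `z j`. -/
theorem FormArc.exists_bound (hw : ∀ i f, 0 ≤ w i f) (K : ℝ) (hK : 0 ≤ K) {i j : V}
    (h : FormArc w C i j) (c : ℝ) :
    ∃ c' : ℝ, ∀ (z : V → ℝ) (m : ℝ), 0 ≤ z → 0 < m → (∀ v ∈ C, m ≤ z v) →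
      weightedForm w z i ≤ K * z i ^ k → z i ≤ c * m → z j ≤ c' * m := by
  obtain ⟨f, hf, hfC, a, rfl⟩ := h
  refine ⟨K * c ^ k / w i f, fun z m hz hm hmz hi hc => ?_⟩
  have hprod : z (f a) * m ^ (k - 1) ≤ ∏ l, z (f l) := by
    rw [← Finset.mul_prod_erase _ _ (Finset.mem_univ a)]
    refine mul_le_mul_of_nonneg_left ?_ (hz _)
    calc m ^ (k - 1) = ∏ _l ∈ Finset.univ.erase a, m := by
          rw [Finset.prod_const, Finset.card_erase_of_mem (Finset.mem_univ a), Finset.card_univ,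
            Fintype.card_fin]
      _ ≤ _ := Finset.prod_le_prod (fun _ _ => hm.le) fun l _ => hmz _ (hfC l)
  have hkm : m ^ k = m * m ^ (k - 1) := by
    rw [← pow_succ', Nat.sub_add_cancel (Nat.one_le_of_lt a.pos)]
  have hle : w i f * (z (f a) * m ^ (k - 1)) ≤ K * c ^ k * (m * m ^ (k - 1)) :=
    calc _ ≤ w i f * ∏ l, z (f l) := mul_le_mul_of_nonneg_left hprod hf.le
      _ ≤ K * z i ^ k := (mul_prod_le_weightedForm hw hz i f).trans hi
      _ ≤ K * (c * m) ^ k := mul_le_mul_of_nonneg_left (pow_le_pow_left₀ (hz i) hc k) hK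
      _ = _ := by rw [mul_pow, hkm, mul_assoc]
  have hpos : 0 < m ^ (k - 1) := pow_pos hm _
  rw [div_mul_eq_mul_div, le_div_iff₀ hf]
  refine le_of_mul_le_mul_right ?_ hpos
  calc _ = w i f * (z (f a) * m ^ (k - 1)) := by ring
    _ ≤ _ := hle
    _ = _ := by ring

theorem exists_bound_of_reflTransGen (hw : ∀ i f, 0 ≤ w i f) (K : ℝ) (hK : 0 ≤ K) {i j : V}
    (hi : i ∈ C) (h : Relation.ReflTransGen (FormArc w C) i j) :
    ∃ c : ℝ, ∀ (z : V → ℝ) (m : ℝ), 0 ≤ z → 0 < m → (∀ v ∈ C, m ≤ z v) →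
      (∀ v ∈ C, weightedForm w z v ≤ K * z v ^ k) → z i ≤ m → z j ≤ c * m := by
  suffices j ∈ C ∧ _ from this.2
  induction h with
  | refl => exact ⟨hi, 1, fun z m _ _ _ _ h => by rwa [one_mul]⟩
  | tail _ hjk ih =>
    obtain ⟨hj, c, hc⟩ := ih
    obtain ⟨c', hc'⟩ := hjk.exists_bound hw K hK c
    obtain ⟨f, -, hfC, a, rfl⟩ := hjk
    exact ⟨hfC a, c', fun z m hz hm hmz hP him =>
      hc' z m hz hm hmz (hP _ hj) (hc z m hz hm hmz hP him)⟩

/-- For a weakly irreducible form, approximate positive super-eigenvectors yield an exact one. -/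
theorem exists_pos_supereigenvector (hw : ∀ i f, 0 ≤ w i f) (hC : C.Nonempty)
    (hirr : ∀ i ∈ C, ∀ j ∈ C, Relation.ReflTransGen (FormArc w C) i j) {l : ℝ} (hl : 0 ≤ l)
    (happ : ∀ δ > 0, ∃ z : V → ℝ, (∀ i, 0 < z i) ∧
      ∀ i, weightedForm w z i ≤ (l + δ) * z i ^ k) :
    ∃ y : V → ℝ, 0 ≤ y ∧ (∀ i ∈ C, 0 < y i) ∧ ∀ i ∈ C, weightedForm w y i ≤ l * y i ^ k := by
  classical
  have hbd : ∀ p : C × C, ∃ c : ℝ, ∀ (z : V → ℝ) (m : ℝ), 0 ≤ z → 0 < m → (∀ v ∈ C, m ≤ z v) →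
      (∀ v ∈ C, weightedForm w z v ≤ (l + 1) * z v ^ k) → z p.1 ≤ m → z p.2 ≤ c * m := fun p =>
    exists_bound_of_reflTransGen hw (l + 1) (by positivity) p.1.2 (hirr _ p.1.2 _ p.2.2)
  choose c hc using hbd
  obtain ⟨D, hD⟩ := Finite.exists_le c
  have hε : ∀ n : ℕ, (0 : ℝ) < 1 / ((n : ℝ) + 1) := fun n => Nat.one_div_pos_of_nat
  have key : ∀ n : ℕ, ∃ y : V → ℝ, y ∈ Set.Icc (0 : V → ℝ) (fun _ => max D 0) ∧
      (∀ i ∈ C, 1 ≤ y i) ∧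
      ∀ i ∈ C, weightedForm w y i ≤ (l + 1 / ((n : ℝ) + 1)) * y i ^ k := by
    intro n
    obtain ⟨z, hz, hPz⟩ := happ _ (hε n)
    obtain ⟨i₀, hi₀, hmin⟩ := C.toFinite.exists_minimalFor z C hC
    have hmin : ∀ v ∈ C, z i₀ ≤ z v := fun v hv => by
      rcases le_total (z i₀) (z v) with h | h
      · exact h
      · exact hmin hv h
    have hm := hz i₀
    have hmi : 0 ≤ (z i₀)⁻¹ := inv_nonneg.mpr hm.le
    have hPz' : ∀ v ∈ C, weightedForm w z v ≤ (l + 1) * z v ^ k := fun v _ =>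
      (hPz v).trans (mul_le_mul_of_nonneg_right
        (add_le_add_right (div_le_one_of_le₀ (by simp) (by positivity)) l)
        (pow_nonneg (hz v).le k))
    -- Nothing bounds `z` off `C`. Setting it to zero there only decreases the form, so the
    -- inequalities on `C` survive; dividing by the minimum over `C` then puts the vectors in a
    -- fixed box.
    have hind : C.indicator z ≤ z := Set.indicator_le_self' fun v _ => (hz v).le
    have hind0 : 0 ≤ C.indicator z := fun v => Set.indicator_nonneg (fun v _ => (hz v).le) v
    have hval : ∀ v ∈ C, ((z i₀)⁻¹ • C.indicator z) v = z v / z i₀ := fun v hv => by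
      rw [Pi.smul_apply, Set.indicator_of_mem hv, smul_eq_mul, inv_mul_eq_div]
    refine ⟨(z i₀)⁻¹ • C.indicator z, ⟨smul_nonneg hmi hind0, fun v => ?_⟩, fun v hv => ?_,
      fun v hv => ?_⟩
    · by_cases hv : v ∈ C
      · rw [hval v hv, div_le_iff₀ hm]
        refine (hc (⟨i₀, hi₀⟩, ⟨v, hv⟩) z (z i₀) (fun u => (hz u).le) hm hmin hPz' le_rfl).trans ?_
        exact mul_le_mul_of_nonneg_right ((hD _).trans (le_max_left _ _)) hm.le
      · rw [Pi.smul_apply, Set.indicator_of_notMem hv, smul_zero]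
        exact le_max_right _ _
    · rw [hval v hv, one_le_div₀ hm]
      exact hmin v hv
    · rw [weightedForm_smul, Pi.smul_apply, Set.indicator_of_mem hv, smul_eq_mul, mul_pow,
        mul_left_comm]
      exact mul_le_mul_of_nonneg_left ((weightedForm_mono hw hind0 hind v).trans (hPz v))
        (pow_nonneg hmi k)
  choose y hy hy1 hPy using key
  obtain ⟨u, hu, φ, hφ, hlim⟩ := (isCompact_Icc (a := (0 : V → ℝ))).tendsto_subseq hy
  have hulim : ∀ i, Tendsto (fun n => y (φ n) i) atTop (𝓝 (u i)) := tendsto_pi_nhds.mp hlim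
  have hε0 : Tendsto (fun n => l + 1 / ((φ n : ℝ) + 1)) atTop (𝓝 (l + 0)) :=
    ((tendsto_one_div_add_atTop_nhds_zero_nat (𝕜 := ℝ)).comp hφ.tendsto_atTop).const_add l
  rw [add_zero] at hε0
  refine ⟨u, hu.1, fun i hi => zero_lt_one.trans_le (ge_of_tendsto' (hulim i) fun n => hy1 _ i hi),
    fun i hi => ?_⟩
  have hPlim : Tendsto (fun n => weightedForm w (y (φ n)) i) atTop (𝓝 (weightedForm w u i)) :=
    (((continuous_apply i).comp (continuous_weightedForm w)).tendsto u).comp hlim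
  exact le_of_tendsto_of_tendsto' hPlim (hε0.mul ((hulim i).pow k)) fun n => hPy _ i hi

theorem eq_of_prod_eq {ι : Type*} [Fintype ι] {a b : ι → ℝ} (ha : ∀ i, 0 ≤ a i)
    (hab : ∀ i, a i ≤ b i) (hb : ∀ i, 0 < b i) (h : ∏ i, a i = ∏ i, b i) (i : ι) : a i = b i := by
  have hpos : 0 < ∏ i, a i := h ▸ Finset.prod_pos fun i _ => hb i
  have ha' : ∀ i, 0 < a i := fun i => lt_of_le_of_ne (ha i) fun h0 =>
    hpos.ne' (Finset.prod_eq_zero (Finset.mem_univ i) h0.symm)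
  by_contra hne
  exact (Finset.prod_lt_prod (fun i _ => ha' i) (fun i _ => hab i)
    ⟨i, Finset.mem_univ i, lt_of_le_of_ne (hab i) hne⟩).ne h

/-- A nonnegative eigenvector of a weakly irreducible form is positive as soon as its eigenvalue
has a positive super-eigenvector. -/
theorem pos_of_supereigenvector (hw : ∀ i f, 0 ≤ w i f)
    (hirr : ∀ i ∈ C, ∀ j ∈ C, Relation.ReflTransGen (FormArc w C) i j) {l : ℝ}
    {x y : V → ℝ} (hx : 0 ≤ x) (hx0 : x ≠ 0) (hxC : Function.support x ⊆ C)
    (hPx : ∀ i, weightedForm w x i = l * x i ^ k) (hy : 0 ≤ y) (hyC : ∀ i ∈ C, 0 < y i)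
    (hPy : ∀ i ∈ C, weightedForm w y i ≤ l * y i ^ k) : ∀ i ∈ C, 0 < x i := by
  obtain ⟨v, hv⟩ := Function.ne_iff.mp hx0
  have hvC : v ∈ C := hxC hv
  obtain ⟨i₀, hi₀, hmax⟩ := C.toFinite.exists_maximalFor (fun i => x i / y i) C ⟨v, hvC⟩
  have hmax : ∀ u ∈ C, x u / y u ≤ x i₀ / y i₀ := fun u hu => by
    rcases le_total (x u / y u) (x i₀ / y i₀) with h | h
    · exact h
    · exact hmax hu h
  set t := x i₀ / y i₀ with ht
  have htpos : 0 < t := lt_of_lt_of_le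
    (div_pos (lt_of_le_of_ne (hx v) (Ne.symm hv)) (hyC v hvC)) (hmax v hvC)
  have hle : x ≤ t • y := fun u => by
    by_cases hu : u ∈ C
    · exact (div_le_iff₀ (hyC u hu)).mp (hmax u hu)
    · rw [Function.notMem_support.mp fun h => hu (hxC h)]
      exact mul_nonneg htpos.le (hy u)
  have hstep : ∀ j, Relation.ReflTransGen (FormArc w C) i₀ j → j ∈ C ∧ x j = t * y j := by
    intro j hj
    induction hj with
    | refl => exact ⟨hi₀, (div_mul_cancel₀ _ (hyC i₀ hi₀).ne').symm⟩
    | @tail i _ _ harc ih =>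
      obtain ⟨hi, hxi⟩ := ih
      obtain ⟨f, hf, hfC, a, rfl⟩ := harc
      refine ⟨hfC a, ?_⟩
      have hterm : ∀ g ∈ (Finset.univ : Finset (Fin k → V)),
          w i g * ∏ j, x (g j) ≤ w i g * ∏ j, (t • y) (g j) := fun g _ =>
        mul_le_mul_of_nonneg_left
          (Finset.prod_le_prod (fun j _ => hx (g j)) fun j _ => hle (g j)) (hw i g)
      -- Squeeze: `P x i ≤ P (t • y) i ≤ l * (t * y i) ^ k = l * x i ^ k = P x i`.
      have hsum : weightedForm w x i = weightedForm w (t • y) i := by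
        refine le_antisymm (weightedForm_mono hw hx hle i) ?_
        rw [weightedForm_smul, hPx, hxi, mul_pow, mul_left_comm]
        exact mul_le_mul_of_nonneg_left (hPy i hi) (pow_nonneg htpos.le k)
      have heq := (Finset.sum_eq_sum_iff_of_le hterm).mp hsum f (Finset.mem_univ f)
      exact eq_of_prod_eq (a := fun j => x (f j)) (b := fun j => (t • y) (f j))
        (fun j => hx _) (fun j => hle _) (fun j => mul_pos htpos (hyC _ (hfC j)))
        (mul_left_cancel₀ hf.ne' heq) a
  intro j hj
  rw [(hstep j (hirr i₀ hi₀ j hj)).2]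
  exact mul_pos htpos (hyC j hj)

end WeightedForm

/-! ### The adjacency tensor and the k-core -/

section AdjTensor

variable {V : Type*} {k : ℕ}

open Classical in
/-- The entries of the `k`-adjacency tensor, as real numbers. -/
noncomputable def adjWeight (G : SimpleGraph V) (k : ℕ) (i : V) (f : Fin k → V) : ℝ :=
  if (∀ j, G.Adj i (f j)) ∧ Function.Injective f then 1 / (k.factorial : ℝ) else 0

theorem adjWeight_nonneg (G : SimpleGraph V) (i : V) (f : Fin k → V) : 0 ≤ adjWeight G k i f := by
  unfold adjWeight
  split_ifs <;> positivity

theorem adjTensor_cons (G : SimpleGraph V) (i : V) (f : Fin k → V) :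
    adjTensor G k (Fin.cons i f) = (adjWeight G k i f : ℂ) := by
  have hiff : ((∀ j : Fin k, (Fin.cons i f : Fin (k + 1) → V) j.succ ∈
      G.neighborSet ((Fin.cons i f : Fin (k + 1) → V) 0)) ∧
      Function.Injective (Fin.cons i f : Fin (k + 1) → V)) ↔
      (∀ j, G.Adj i (f j)) ∧ Function.Injective f := by
    simp only [Fin.cons_succ, Fin.cons_zero, SimpleGraph.mem_neighborSet, Fin.cons_injective_iff]
    refine and_congr_right fun h => and_iff_right ?_
    rintro ⟨j, hj⟩
    exact G.loopless.irrefl i (hj ▸ h j)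
  unfold adjTensor adjWeight
  by_cases h : (∀ j, G.Adj i (f j)) ∧ Function.Injective f
  · rw [if_pos h]
    refine (if_pos (hiff.mpr h)).trans ?_
    push_cast
    rfl
  · rw [if_neg h, Complex.ofReal_zero]
    exact if_neg fun h' => h (hiff.mp h')

variable [Fintype V]

theorem applyVec_adjTensor (G : SimpleGraph V) (x : V → ℂ) (i : V) :
    (adjTensor G k).applyVec x i = ∑ f : Fin k → V, (adjWeight G k i f : ℂ) * ∏ j, x (f j) := by
  unfold Tensor.applyVec
  simp only [adjTensor_cons]

theorem applyVec_adjTensor_ofReal (G : SimpleGraph V) (x : V → ℝ) (i : V) :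
    (adjTensor G k).applyVec (fun v => (x v : ℂ)) i = (weightedForm (adjWeight G k) x i : ℂ) := by
  rw [applyVec_adjTensor, weightedForm]
  push_cast
  rfl

theorem norm_applyVec_adjTensor_le (G : SimpleGraph V) (x : V → ℂ) (i : V) :
    ‖(adjTensor G k).applyVec x i‖ ≤ weightedForm (adjWeight G k) (fun v => ‖x v‖) i := by
  rw [applyVec_adjTensor]
  refine (norm_sum_le _ _).trans (Finset.sum_le_sum fun f _ => ?_)
  rw [norm_mul, norm_prod, Complex.norm_of_nonneg (adjWeight_nonneg G i f)]

theorem isEigenvector_ofReal_iff {G : SimpleGraph V} {l : ℝ} {x : V → ℝ} :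
    (adjTensor G k).IsEigenvector (l : ℂ) (fun v => (x v : ℂ)) ↔
      x ≠ 0 ∧ ∀ i, weightedForm (adjWeight G k) x i = l * x i ^ k := by
  refine and_congr ?_ (forall_congr' fun i => ?_)
  · simp only [ne_eq, funext_iff, Pi.zero_apply, Complex.ofReal_eq_zero]
  · rw [applyVec_adjTensor_ofReal]
    dsimp only
    norm_cast

theorem exists_injective_of_le_ncard {S : Set V} (hk : 1 ≤ k) (hS : k ≤ S.ncard) {j : V}
    (hj : j ∈ S) : ∃ f : Fin k → V, Function.Injective f ∧ (∀ l, f l ∈ S) ∧ j ∈ Set.range f := by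
  classical
  have hcard : Fintype.card (Fin k) ≤ Fintype.card S := by
    rwa [Fintype.card_fin, ← Nat.card_eq_fintype_card, Nat.card_coe_set_eq]
  obtain ⟨g⟩ := Function.Embedding.nonempty_of_card_le hcard
  refine ⟨fun l => (Equiv.swap (g ⟨0, hk⟩) ⟨j, hj⟩ (g l) : S), ?_, fun l => Subtype.coe_prop _,
    ⟨0, hk⟩, ?_⟩
  · exact Subtype.coe_injective.comp ((Equiv.injective _).comp g.injective)
  · simp

theorem exists_adjWeight_pos {G : SimpleGraph V} {C : Set V} (hk : 1 ≤ k) {i j : V}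
    (hi : k ≤ (G.neighborSet i ∩ C).ncard) (hj : j ∈ G.neighborSet i ∩ C) :
    ∃ f : Fin k → V, adjWeight G k i f = 1 / (k.factorial : ℝ) ∧ (∀ l, f l ∈ C) ∧
      j ∈ Set.range f := by
  obtain ⟨f, hf, hfS, hjf⟩ := exists_injective_of_le_ncard hk hi hj
  exact ⟨f, if_pos ⟨fun l => (hfS l).1, hf⟩, fun l => (hfS l).2, hjf⟩

theorem IsKCore.le_ncard {G : SimpleGraph V} {H : G.Subgraph} (hH : IsKCore G k H) {v : V}
    (hv : v ∈ H.verts) : k ≤ (G.neighborSet v ∩ H.verts).ncard :=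
  (hH.prop.2 v hv).trans (Set.ncard_le_ncard fun _ hu => ⟨H.adj_sub hu, H.edge_vert hu.symm⟩)

/-- Joining the subgraph induced on `S` to `H` preserves the degree condition, so maximality absorbs
it. -/
theorem IsKCore.subset_verts {G : SimpleGraph V} {H : G.Subgraph} (hH : IsKCore G k H)
    {S : Set V} (hS : ∀ v ∈ S, k ≤ (G.neighborSet v ∩ S).ncard) : S ⊆ H.verts := by
  have hle : H ⊔ (⊤ : G.Subgraph).induce S ≤ H := by
    refine hH.le_of_ge ⟨hH.prop.1.mono fun _ h => Or.inl h, ?_⟩ le_sup_left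
    rintro v (hv | hv)
    · exact (hH.prop.2 v hv).trans (Set.ncard_le_ncard fun u hu => Or.inl hu)
    · exact (hS v hv).trans (Set.ncard_le_ncard fun u hu => Or.inr ⟨hv, hu.2, hu.1⟩)
  exact fun v hv => hle.1 (Or.inr hv)

theorem support_subset_kCore {G : SimpleGraph V} {H : G.Subgraph} (hH : IsKCore G k H)
    {l : ℝ} (hl : 0 < l) {x : V → ℝ} (hx : 0 ≤ x)
    (hPx : ∀ i, weightedForm (adjWeight G k) x i = l * x i ^ k) :
    Function.support x ⊆ H.verts := by
  refine hH.subset_verts fun v hv => ?_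
  have hpos : 0 < weightedForm (adjWeight G k) x v := by
    rw [hPx]
    exact mul_pos hl (pow_pos (lt_of_le_of_ne (hx v) (Ne.symm hv)) k)
  obtain ⟨f, -, hf⟩ := Finset.exists_ne_zero_of_sum_ne_zero hpos.ne'
  have hfx : ∀ j, x (f j) ≠ 0 := fun j => Finset.prod_ne_zero_iff.mp (right_ne_zero_of_mul hf) j
    (Finset.mem_univ j)
  have hfG : (∀ j, G.Adj v (f j)) ∧ Function.Injective f := by
    by_contra hcon
    exact left_ne_zero_of_mul hf (if_neg hcon)
  calc k = (Set.range f).ncard := by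
        rw [← Set.image_univ, Set.ncard_image_of_injective _ hfG.2, Set.ncard_univ,
          Nat.card_eq_fintype_card, Fintype.card_fin]
    _ ≤ _ := Set.ncard_le_ncard (by rintro _ ⟨j, rfl⟩; exact ⟨hfG.1 j, hfx j⟩)

theorem reflTransGen_formArc_of_connected {G : SimpleGraph V} {C : Set V} (hk : 1 ≤ k)
    (hC : ∀ v ∈ C, k ≤ (G.neighborSet v ∩ C).ncard) (hcon : (G.induce C).Connected) :
    ∀ i ∈ C, ∀ j ∈ C, Relation.ReflTransGen (FormArc (adjWeight G k) C) i j := by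
  intro i hi j hj
  have h := (SimpleGraph.reachable_iff_reflTransGen _ _).mp (hcon.preconnected ⟨i, hi⟩ ⟨j, hj⟩)
  refine h.lift (fun u : C => (u : V)) fun u v huv => ?_
  obtain ⟨f, hf, hfC, hv⟩ := exists_adjWeight_pos hk (hC u u.2) ⟨SimpleGraph.induce_adj.mp huv, v.2⟩
  exact ⟨f, by rw [hf]; positivity, hfC, hv⟩

/-- The spectral radius exists, is positive, belongs to a Perron eigenvector, and is approximated by
values having positive super-eigenvectors. -/
theorem IsKCore.exists_isSpectralRadius {G : SimpleGraph V} {H : G.Subgraph} (hk : 1 ≤ k)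
    (hH : IsKCore G k H) :
    ∃ l : ℝ, 0 < l ∧ (adjTensor G k).IsSpectralRadius l ∧ (∃ x, IsPerronEigenvector G k x) ∧
      ∀ δ > 0, ∃ z : V → ℝ, (∀ i, 0 < z i) ∧
        ∀ i, weightedForm (adjWeight G k) z i ≤ (l + δ) * z i ^ k := by
  classical
  have hw := adjWeight_nonneg G (k := k)
  obtain ⟨v₀, hv₀⟩ := hH.prop.1
  have : Nonempty V := ⟨v₀⟩
  obtain ⟨l, x, hl, hx, hPx, hmax, happ⟩ := exists_perron_eigenvector (k := k) (by omega)
    (weightedForm (adjWeight G k)) (continuous_weightedForm _)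
    (fun x hx => weightedForm_nonneg hw hx) (fun c _ x i => weightedForm_smul _ c x i)
    fun x y hx hxy => weightedForm_mono hw hx hxy
  have hx0 : x ≠ 0 := by
    rintro rfl
    simpa using hx.2
  have heig : (adjTensor G k).IsEigenvector (l : ℂ) (fun v => (x v : ℂ)) :=
    isEigenvector_ofReal_iff.mpr ⟨hx0, hPx⟩
  have hrad : (adjTensor G k).IsSpectralRadius l := by
    refine ⟨⟨l, ⟨_, heig⟩, Complex.norm_of_nonneg hl⟩, ?_⟩
    rintro _ ⟨μ, ⟨z, hz0, hz⟩, rfl⟩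
    refine hmax ‖μ‖ (fun v => ‖z v‖) (fun v => norm_nonneg _) (fun h => hz0 ?_) fun i => ?_
    · exact funext fun v => norm_eq_zero.mp (congrFun h v)
    · calc ‖μ‖ * ‖z i‖ ^ k = ‖(adjTensor G k).applyVec z i‖ := by rw [hz, norm_mul, norm_pow]
        _ ≤ _ := norm_applyVec_adjTensor_le G z i
  refine ⟨l, ?_, hrad, ⟨x, hx.1, l, hrad, heig⟩, happ⟩
  have hind0 : 0 ≤ H.verts.indicator (1 : V → ℝ) :=
    fun v => Set.indicator_nonneg (fun _ _ => zero_le_one) v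
  -- At a core vertex a single monomial supported in the core already contributes `1 / k!` to the
  -- form at the indicator of the core.
  refine lt_of_lt_of_le (by positivity : 0 < 1 / (k.factorial : ℝ))
    (hmax _ (H.verts.indicator 1) hind0 (fun h => ?_) fun i => ?_)
  · have := congrFun h v₀
    simp [hv₀] at this
  · by_cases hi : i ∈ H.verts
    · have hdeg := hH.le_ncard hi
      obtain ⟨j, hj⟩ := Set.nonempty_of_ncard_ne_zero (by omega : (G.neighborSet i ∩ H.verts).ncard ≠ 0)
      obtain ⟨f, hf, hfC, -⟩ := exists_adjWeight_pos hk hdeg hj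
      refine le_trans (le_of_eq ?_) (mul_prod_le_weightedForm hw hind0 i f)
      simp [hf, hi, hfC]
    · rw [Set.indicator_of_notMem hi, zero_pow (by omega), mul_zero]
      exact weightedForm_nonneg hw hind0 i

end AdjTensor

end KCoreSpectra

theorem theorem2 {V : Type*} [Fintype V] (G : SimpleGraph V) (k : ℕ) (hk : 1 ≤ k)
    (H : G.Subgraph) (hH : KCoreSpectra.IsKCore G k H) :
    (∃ x : V → ℝ, KCoreSpectra.IsPerronEigenvector G k x) ∧
    ∀ x : V → ℝ, KCoreSpectra.IsPerronEigenvector G k x →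
      Function.support x ⊆ H.verts ∧
      ((G.induce H.verts).Connected → Function.support x = H.verts) := by
  obtain ⟨l, hl, hrad, hex, happ⟩ := hH.exists_isSpectralRadius hk
  refine ⟨hex, fun x ⟨hx, ρ, hρ, heig⟩ => ?_⟩
  obtain rfl : ρ = l := hρ.unique hrad
  obtain ⟨hx0, hPx⟩ := KCoreSpectra.isEigenvector_ofReal_iff.mp heig
  have hsub := KCoreSpectra.support_subset_kCore hH hl hx hPx
  refine ⟨hsub, fun hcon => hsub.antisymm fun v hv => ?_⟩
  have hw := KCoreSpectra.adjWeight_nonneg G (k := k)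
  have hirr := KCoreSpectra.reflTransGen_formArc_of_connected hk (fun _ h => hH.le_ncard h) hcon
  obtain ⟨y, hy, hyC, hPy⟩ :=
    KCoreSpectra.exists_pos_supereigenvector hw ⟨v, hv⟩ hirr hl.le happ
  exact (KCoreSpectra.pos_of_supereigenvector hw hirr hx hx0 hsub hPx hy hyC hPy v hv).ne'
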